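/- For a real number $\epsilon\ge 0$ let $A_\epsilon$ be the universal unital $C^*$-algebra generated by two unitaries $u,v$ subject to the relation $\|uv-vu\|\le\epsilon$. Then for every $\epsilon\ge 0$ the $C^*$-algebra $A_\epsilon$ has a faithful tracial state, that is, a positive linear functional $\tau: A_\epsilon\to\mathbb{C}$ with $\tau(1)=1$, $\tau(xy)=\tau(yx)$ for all $x,y\in A_\epsilon$, and $\tau(x^*x)=0$ only for $x=0$. Furthermore, every hyponormal element of $A_\epsilon$ is normal: if $x\in A_\epsilon$ and $x^*x\ge xx^*$, then $x^*x=xx^*$. -/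

import Mathlib

noncomputable section

open scoped ComplexOrder

/-! ### The complex group algebra as a `*`-algebra -/

section GroupStarAlgebra

variable {G : Type*} [Group G]

/-- The involution `(∑ c_g g)^* = ∑ conj(c_g) g⁻¹` of the complex group algebra, as an additive
map. -/
def groupAlgebraStar : MonoidAlgebra ℂ G →+ MonoidAlgebra ℂ G where
  toFun x := MonoidAlgebra.map (starRingEnd ℂ : ℂ →+ ℂ)
    (MonoidAlgebra.mapDomain (fun g : G => g⁻¹) x)
  map_zero' := by simp
  map_add' x y := by simp [MonoidAlgebra.mapDomain_add, MonoidAlgebra.map_add]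

theorem groupAlgebraStar_single (g : G) (c : ℂ) :
    groupAlgebraStar (MonoidAlgebra.single g c) =
      MonoidAlgebra.single g⁻¹ (starRingEnd ℂ c) := by
  simp [groupAlgebraStar, MonoidAlgebra.map_single]

theorem groupAlgebraStar_mul (x y : MonoidAlgebra ℂ G) :
    groupAlgebraStar (x * y) = groupAlgebraStar y * groupAlgebraStar x := by
  induction x using MonoidAlgebra.induction_linear with
  | zero => simp
  | add x₁ x₂ h₁ h₂ => simp [add_mul, mul_add, h₁, h₂]
  | single g c =>
    induction y using MonoidAlgebra.induction_linear with
    | zero => simp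
    | add y₁ y₂ h₁ h₂ => simp [add_mul, mul_add, h₁, h₂]
    | single h d =>
      simp [groupAlgebraStar_single, MonoidAlgebra.single_mul_single, mul_comm]

instance groupAlgebraStarRing : StarRing (MonoidAlgebra ℂ G) where
  star := groupAlgebraStar
  star_involutive x := by
    induction x using MonoidAlgebra.induction_linear with
    | zero => simp
    | add x₁ x₂ h₁ h₂ => simp [h₁, h₂]
    | single g c => simp [groupAlgebraStar_single]
  star_mul x y := groupAlgebraStar_mul x y
  star_add x y := map_add _ x y

theorem groupAlgebra_star_single (g : G) (c : ℂ) :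
    star (MonoidAlgebra.single g c) = MonoidAlgebra.single g⁻¹ (star c) :=
  groupAlgebraStar_single g c

instance groupAlgebraStarModule : StarModule ℂ (MonoidAlgebra ℂ G) where
  star_smul c x := by
    induction x using MonoidAlgebra.induction_linear with
    | zero => simp
    | add x₁ x₂ h₁ h₂ => simp [h₁, h₂]
    | single g d => simp [groupAlgebra_star_single, MonoidAlgebra.smul_single]

end GroupStarAlgebra

/-! ### `C*`-seminorms and the `C*`-algebra obtained by separation and completion -/

/-- A `C*`-seminorm on a unital complex `*`-algebra. -/
structure CStarSeminorm (A : Type*) [Ring A] [Algebra ℂ A] [StarRing A] extends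
    Seminorm ℂ A where
  mul_le' : ∀ x y : A, toFun (x * y) ≤ toFun x * toFun y
  star_mul_self' : ∀ x : A, toFun (star x * x) = toFun x * toFun x

namespace CStarSeminorm

variable {A : Type*} [Ring A] [Algebra ℂ A] [StarRing A]

instance : CoeFun (CStarSeminorm A) (fun _ => A → ℝ) := ⟨fun p => p.toSeminorm⟩

theorem mul_le (p : CStarSeminorm A) (x y : A) : p (x * y) ≤ p x * p y := p.mul_le' x y

theorem star_mul_self (p : CStarSeminorm A) (x : A) : p (star x * x) = p x * p x :=
  p.star_mul_self' x

theorem nonneg (p : CStarSeminorm A) (x : A) : 0 ≤ p x := apply_nonneg p.toSeminorm x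

theorem le_star (p : CStarSeminorm A) (x : A) : p x ≤ p (star x) := by
  rcases (p.nonneg x).eq_or_lt with h | h
  · rw [← h]; exact p.nonneg _
  · have := p.mul_le (star x) x
    rw [p.star_mul_self] at this
    exact le_of_mul_le_mul_right this h

theorem map_star (p : CStarSeminorm A) (x : A) : p (star x) = p x :=
  le_antisymm (by simpa using p.le_star (star x)) (p.le_star x)

theorem one_le (p : CStarSeminorm A) : p 1 ≤ 1 := by
  have h := p.star_mul_self 1
  simp only [star_one, mul_one] at h
  nlinarith [p.nonneg 1]

/-- The `*`-algebra `A`, regarded as a seminormed algebra with seminorm `p`. -/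
@[nolint unusedArguments]
def Carrier (_p : CStarSeminorm A) : Type _ := A

variable (p : CStarSeminorm A)

instance : Ring p.Carrier := inferInstanceAs (Ring A)
instance : Algebra ℂ p.Carrier := inferInstanceAs (Algebra ℂ A)
instance : StarRing p.Carrier := inferInstanceAs (StarRing A)
instance [StarModule ℂ A] : StarModule ℂ p.Carrier := inferInstanceAs (StarModule ℂ A)

/-- The identity map from `A` to `p.Carrier`. -/
def toCarrier : A →⋆ₐ[ℂ] p.Carrier := StarAlgHom.id ℂ A

instance : SeminormedRing p.Carrier :=
  { (inferInstance : Ring p.Carrier),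
    p.toSeminorm.toAddGroupSeminorm.toSeminormedAddCommGroup with
    norm_mul_le := fun x y => p.mul_le x y }

theorem norm_toCarrier (x : A) : ‖p.toCarrier x‖ = p x := rfl

instance : NormedAlgebra ℂ p.Carrier :=
  { (inferInstance : Algebra ℂ p.Carrier) with
    norm_smul_le := fun c x => (map_smul_eq_mul p.toSeminorm c x).le }

instance : NormedStarGroup p.Carrier where
  norm_star_le x := (p.map_star x).le

/-- The Hausdorff completion of `A` with respect to the `C*`-seminorm `p`. -/
def Compl : Type _ := UniformSpace.Completion p.Carrier

open UniformSpace

instance : NormedRing p.Compl := inferInstanceAs (NormedRing (Completion p.Carrier))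
instance : CompleteSpace p.Compl := inferInstanceAs (CompleteSpace (Completion p.Carrier))

instance : Algebra ℂ p.Compl := inferInstanceAs (Algebra ℂ (Completion p.Carrier))

instance : NormedAlgebra ℂ p.Compl where
  norm_smul_le c x := norm_smul_le (α := ℂ) (β := Completion p.Carrier) c x

/-- The canonical ring homomorphism of `A` into its completion. -/
def coe : A →+* p.Compl :=
  (Completion.coeRingHom : p.Carrier →+* Completion p.Carrier).comp (p.toCarrier : A →+* p.Carrier)

theorem norm_coe (x : A) : ‖p.coe x‖ = p x := Completion.norm_coe (p.toCarrier x)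

theorem denseRange_coe : DenseRange p.coe := Completion.denseRange_coe (α := p.Carrier)

theorem coe_smul (c : ℂ) (x : A) : p.coe (c • x) = c • p.coe x :=
  Completion.coe_smul (M := ℂ) (X := p.Carrier) c (p.toCarrier x)

instance : Star p.Compl := ⟨Completion.map (star : p.Carrier → p.Carrier)⟩

theorem continuous_star_compl : Continuous (star : p.Compl → p.Compl) :=
  Completion.continuous_map

theorem star_coe (x : A) : star (p.coe x) = p.coe (star x) :=
  Completion.map_coe (f := (star : p.Carrier → p.Carrier))
    (starNormedAddGroupHom (E := p.Carrier)).uniformContinuous (p.toCarrier x)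

variable {p} in
theorem compl_induction {P : p.Compl → Prop} (x : p.Compl) (hc : IsClosed {y | P y})
    (h : ∀ a : A, P (p.coe a)) : P x :=
  p.denseRange_coe.induction_on x hc h

variable {p} in
theorem compl_induction₂ {P : p.Compl → p.Compl → Prop} (x y : p.Compl)
    (hc : IsClosed {z : p.Compl × p.Compl | P z.1 z.2})
    (h : ∀ a b : A, P (p.coe a) (p.coe b)) : P x y :=
  p.denseRange_coe.induction_on₂ hc h x y

instance : StarRing p.Compl where
  star_involutive x := by
    have := p.continuous_star_compl
    refine compl_induction (P := fun x => star (star x) = x) x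
      (isClosed_eq (by fun_prop) (by fun_prop)) fun a => ?_
    simp [star_coe]
  star_mul x y := by
    have := p.continuous_star_compl
    refine compl_induction₂ (P := fun x y => star (x * y) = star y * star x) x y
      (isClosed_eq (by fun_prop) (by fun_prop)) fun a b => ?_
    simp [star_coe, ← map_mul]
  star_add x y := by
    have := p.continuous_star_compl
    refine compl_induction₂ (P := fun x y => star (x + y) = star x + star y) x y
      (isClosed_eq (by fun_prop) (by fun_prop)) fun a b => ?_
    simp [star_coe, ← map_add]

instance : CStarRing p.Compl where
  norm_mul_self_le x := by
    have := p.continuous_star_compl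
    refine compl_induction (P := fun x => ‖x‖ * ‖x‖ ≤ ‖star x * x‖) x
      (isClosed_le (by fun_prop) (by fun_prop)) fun a => ?_
    rw [star_coe, ← map_mul, norm_coe, norm_coe, star_mul_self]

instance [StarModule ℂ A] : StarModule ℂ p.Compl where
  star_smul c x := by
    have := p.continuous_star_compl
    have hs : ∀ c : ℂ, Continuous fun x : p.Compl => c • x := fun c => continuous_const_smul c
    refine compl_induction (P := fun x => star (c • x) = star c • star x) x
      (isClosed_eq (this.comp (hs c)) ((hs (star c)).comp this)) fun a => ?_
    rw [star_coe, ← coe_smul, ← coe_smul, star_coe, star_smul]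

instance [StarModule ℂ A] : CStarAlgebra p.Compl where

section Lift

variable {B : Type*} [CStarAlgebra B] (φ : A →⋆ₐ[ℂ] B)

/-- The continuous extension to the completion of a `*`-homomorphism `φ` with `‖φ a‖ ≤ p a`, as a
function. -/
def extend : p.Compl → B :=
  Completion.extension (fun x : p.Carrier => φ (show A from x))

theorem continuous_extend : Continuous (p.extend φ) := Completion.continuous_extension

theorem extend_coe (hφ : ∀ a, ‖φ a‖ ≤ p a) (a : A) : p.extend φ (p.coe a) = φ a := by
  let f : p.Carrier →+ B :=
    { toFun := fun x => φ (show A from x)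
      map_zero' := map_zero φ
      map_add' := map_add φ }
  exact Completion.extension_coe (f := f)
    (AddMonoidHomClass.uniformContinuous_of_bound f 1 fun x => by
      rw [one_mul]; exact hφ x) (p.toCarrier a)

/-- A unital `*`-homomorphism `φ` from `A` to a `C*`-algebra with `‖φ a‖ ≤ p a` extends to the
completion. -/
def lift [StarModule ℂ A] (hφ : ∀ a, ‖φ a‖ ≤ p a) : p.Compl →⋆ₐ[ℂ] B where
  toFun := p.extend φ
  map_one' := by rw [← map_one p.coe, p.extend_coe φ hφ, map_one]
  map_zero' := by rw [← map_zero p.coe, p.extend_coe φ hφ, map_zero]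
  map_mul' x y := by
    have hc := p.continuous_extend φ
    refine compl_induction₂ x y (P := fun x y => p.extend φ (x * y) = p.extend φ x * p.extend φ y)
      (isClosed_eq (by fun_prop) (by fun_prop)) fun a b => ?_
    simp only [← map_mul, p.extend_coe φ hφ]
  map_add' x y := by
    have hc := p.continuous_extend φ
    refine compl_induction₂ x y (P := fun x y => p.extend φ (x + y) = p.extend φ x + p.extend φ y)
      (isClosed_eq (by fun_prop) (by fun_prop)) fun a b => ?_
    simp only [← map_add, p.extend_coe φ hφ]
  commutes' c := by
    rw [Algebra.algebraMap_eq_smul_one, ← map_one p.coe, ← coe_smul, p.extend_coe φ hφ, map_smul,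
      map_one, Algebra.algebraMap_eq_smul_one]
  map_star' x := by
    have hc := p.continuous_extend φ
    have hs := p.continuous_star_compl
    refine compl_induction x (P := fun x => p.extend φ (star x) = star (p.extend φ x))
      (isClosed_eq (hc.comp hs) (continuous_star.comp hc)) fun a => ?_
    rw [star_coe, p.extend_coe φ hφ, p.extend_coe φ hφ, StarHomClass.map_star]

theorem lift_coe [StarModule ℂ A] (hφ : ∀ a, ‖φ a‖ ≤ p a) (a : A) :
    p.lift φ hφ (p.coe a) = φ a :=
  p.extend_coe φ hφ a

end Lift

/-- The `C*`-seminorm `a ↦ ‖φ a‖` of a unital `*`-homomorphism `φ` into a `C*`-algebra. -/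
def ofHom {B : Type*} [CStarAlgebra B] (φ : A →⋆ₐ[ℂ] B) : CStarSeminorm A where
  toSeminorm := (normSeminorm ℂ B).comp (φ : A →ₗ[ℂ] B)
  mul_le' x y := by
    change ‖φ (x * y)‖ ≤ ‖φ x‖ * ‖φ y‖
    rw [map_mul]; exact norm_mul_le _ _
  star_mul_self' x := by
    change ‖φ (star x * x)‖ = ‖φ x‖ * ‖φ x‖
    rw [map_mul, StarHomClass.map_star, CStarRing.norm_star_mul_self]

theorem ofHom_apply {B : Type*} [CStarAlgebra B] (φ : A →⋆ₐ[ℂ] B) (x : A) :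
    ofHom φ x = ‖φ x‖ := rfl

end CStarSeminorm

/-! ### The soft torus -/

/-- The group algebra of the free group on two generators: the universal unital complex
`*`-algebra generated by two unitaries. -/
abbrev TwoUnitaries : Type := MonoidAlgebra ℂ (FreeGroup (Fin 2))

namespace TwoUnitaries

/-- The first generator. -/
def u : TwoUnitaries := MonoidAlgebra.single (FreeGroup.of 0) 1

/-- The second generator. -/
def v : TwoUnitaries := MonoidAlgebra.single (FreeGroup.of 1) 1

theorem u_mem : u ∈ unitary TwoUnitaries := by
  rw [Unitary.mem_iff]
  simp [u, groupAlgebra_star_single, MonoidAlgebra.single_mul_single, MonoidAlgebra.one_def]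

theorem v_mem : v ∈ unitary TwoUnitaries := by
  rw [Unitary.mem_iff]
  simp [v, groupAlgebra_star_single, MonoidAlgebra.single_mul_single, MonoidAlgebra.one_def]

/-- The unital `*`-homomorphism determined by two unitaries `a`, `b`. -/
def lift {B : Type*} [CStarAlgebra B] (a b : unitary B) : TwoUnitaries →⋆ₐ[ℂ] B :=
  { MonoidAlgebra.lift ℂ B (FreeGroup (Fin 2))
      ((unitary B).subtype.comp (FreeGroup.lift ![a, b])) with
    map_star' := fun x => by
      change MonoidAlgebra.lift ℂ B (FreeGroup (Fin 2)) _ (star x) =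
        star (MonoidAlgebra.lift ℂ B (FreeGroup (Fin 2)) _ x)
      induction x using MonoidAlgebra.induction_linear with
      | zero => simp
      | add x₁ x₂ h₁ h₂ => simp only [star_add, map_add, h₁, h₂]
      | single g c =>
        rw [groupAlgebra_star_single, MonoidAlgebra.lift_single, MonoidAlgebra.lift_single,
          star_smul]
        simp [← Unitary.star_eq_inv] }

theorem lift_single {B : Type*} [CStarAlgebra B] (a b : unitary B) (g : FreeGroup (Fin 2)) (c : ℂ) :
    lift a b (MonoidAlgebra.single g c) = c • (FreeGroup.lift ![a, b] g : B) :=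
  MonoidAlgebra.lift_single _ _ _

theorem lift_u {B : Type*} [CStarAlgebra B] (a b : unitary B) : lift a b u = a := by
  simp [u, lift_single]

theorem lift_v {B : Type*} [CStarAlgebra B] (a b : unitary B) : lift a b v = b := by
  simp [v, lift_single]

theorem seminorm_single_le (p : CStarSeminorm TwoUnitaries) (g : FreeGroup (Fin 2)) (c : ℂ) :
    p (MonoidAlgebra.single g c) ≤ ‖c‖ := by
  have h1 : p (MonoidAlgebra.single g 1) ≤ 1 := by
    have h := p.star_mul_self (MonoidAlgebra.single g 1)
    have h' : star (MonoidAlgebra.single g (1 : ℂ)) * MonoidAlgebra.single g 1 = 1 := by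
      simp [groupAlgebra_star_single, MonoidAlgebra.single_mul_single, MonoidAlgebra.one_def]
    rw [h'] at h
    nlinarith [p.one_le, p.nonneg (MonoidAlgebra.single g 1)]
  have h2 : MonoidAlgebra.single g c = c • MonoidAlgebra.single g (1 : ℂ) := by
    simp [MonoidAlgebra.smul_single]
  rw [h2]
  calc p (c • MonoidAlgebra.single g (1 : ℂ)) = ‖c‖ * p (MonoidAlgebra.single g 1) :=
        map_smul_eq_mul p.toSeminorm c _
    _ ≤ ‖c‖ * 1 := by gcongr
    _ = ‖c‖ := mul_one _

theorem exists_bound (x : TwoUnitaries) : ∃ C : ℝ, ∀ p : CStarSeminorm TwoUnitaries, p x ≤ C := by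
  induction x using MonoidAlgebra.induction_linear with
  | zero => exact ⟨0, fun p => (map_zero p.toSeminorm).le⟩
  | add x y hx hy =>
    obtain ⟨C, hC⟩ := hx
    obtain ⟨D, hD⟩ := hy
    exact ⟨C + D, fun p => (map_add_le_add p.toSeminorm x y).trans (add_le_add (hC p) (hD p))⟩
  | single g c => exact ⟨‖c‖, fun p => seminorm_single_le p g c⟩

end TwoUnitaries

/-- The `C*`-seminorms `p` on the universal `*`-algebra generated by two unitaries `u`, `v` for
which `p (u v - v u) ≤ ε`. -/
def SoftSeminorms (ε : ℝ) : Set (CStarSeminorm TwoUnitaries) :=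
  {p | p (TwoUnitaries.u * TwoUnitaries.v - TwoUnitaries.v * TwoUnitaries.u) ≤ ε}

theorem softSeminorms_bddAbove (ε : ℝ) (x : TwoUnitaries) :
    BddAbove (Set.range fun p : SoftSeminorms ε => p.1 x) := by
  obtain ⟨C, hC⟩ := TwoUnitaries.exists_bound x
  exact ⟨C, by rintro _ ⟨p, rfl⟩; exact hC p.1⟩

theorem le_iSup_softSeminorms {ε : ℝ} (p : SoftSeminorms ε) (x : TwoUnitaries) :
    p.1 x ≤ ⨆ q : SoftSeminorms ε, q.1 x :=
  le_ciSup (softSeminorms_bddAbove ε x) p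

theorem iSup_softSeminorms_nonneg (ε : ℝ) (x : TwoUnitaries) :
    0 ≤ ⨆ q : SoftSeminorms ε, q.1 x :=
  Real.iSup_nonneg fun q => q.1.nonneg x

/-- The largest `C*`-seminorm `p` with `p (u v - v u) ≤ ε`: the supremum of all of them. -/
def softSeminorm (ε : ℝ) : CStarSeminorm TwoUnitaries where
  toFun x := ⨆ p : SoftSeminorms ε, p.1 x
  map_zero' := by
    have (p : SoftSeminorms ε) : p.1 0 = 0 := map_zero p.1.toSeminorm
    simp [this]
  add_le' x y := Real.iSup_le (fun p => (map_add_le_add p.1.toSeminorm x y).trans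
      (add_le_add (le_iSup_softSeminorms p x) (le_iSup_softSeminorms p y)))
    (add_nonneg (iSup_softSeminorms_nonneg ε x) (iSup_softSeminorms_nonneg ε y))
  neg' x := by
    have (p : SoftSeminorms ε) : p.1 (-x) = p.1 x := map_neg_eq_map p.1.toSeminorm x
    simp only [this]
  smul' c x := by
    have (p : SoftSeminorms ε) : p.1 (c • x) = ‖c‖ * p.1 x := map_smul_eq_mul p.1.toSeminorm c x
    simp only [this]
    exact (Real.mul_iSup_of_nonneg (norm_nonneg c) _).symm
  mul_le' x y := Real.iSup_le (fun p => (p.1.mul_le x y).trans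
      (mul_le_mul (le_iSup_softSeminorms p x) (le_iSup_softSeminorms p y) (p.1.nonneg y)
        (iSup_softSeminorms_nonneg ε x)))
    (mul_nonneg (iSup_softSeminorms_nonneg ε x) (iSup_softSeminorms_nonneg ε y))
  star_mul_self' x := by
    change (⨆ p : SoftSeminorms ε, p.1 (star x * x)) =
      (⨆ p : SoftSeminorms ε, p.1 x) * (⨆ p : SoftSeminorms ε, p.1 x)
    simp only [fun p : SoftSeminorms ε => p.1.star_mul_self x]
    have h0 : 0 ≤ ⨆ p : SoftSeminorms ε, p.1 x * p.1 x :=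
      Real.iSup_nonneg fun p => mul_nonneg (p.1.nonneg x) (p.1.nonneg x)
    refine le_antisymm (Real.iSup_le (fun p => mul_le_mul (le_iSup_softSeminorms p x)
      (le_iSup_softSeminorms p x) (p.1.nonneg x) (iSup_softSeminorms_nonneg ε x))
      (mul_nonneg (iSup_softSeminorms_nonneg ε x) (iSup_softSeminorms_nonneg ε x))) ?_
    have hb : BddAbove (Set.range fun p : SoftSeminorms ε => p.1 x * p.1 x) := by
      have := softSeminorms_bddAbove ε (star x * x)
      simpa only [fun p : SoftSeminorms ε => p.1.star_mul_self x] using this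
    have hs : (⨆ p : SoftSeminorms ε, p.1 x) ≤ √(⨆ p : SoftSeminorms ε, p.1 x * p.1 x) :=
      Real.iSup_le (fun p => Real.le_sqrt_of_sq_le (by rw [sq]; exact le_ciSup hb p))
        (Real.sqrt_nonneg _)
    calc _ ≤ √(⨆ p : SoftSeminorms ε, p.1 x * p.1 x) * √(⨆ p : SoftSeminorms ε, p.1 x * p.1 x) :=
          mul_le_mul hs hs (iSup_softSeminorms_nonneg ε x) (Real.sqrt_nonneg _)
      _ = _ := Real.mul_self_sqrt h0

/-- The soft torus `A_ε`: the universal unital `C*`-algebra generated by two unitaries `u`, `v`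
with `‖u v - v u‖ ≤ ε`. -/
def SoftTorus (ε : ℝ) : Type := (softSeminorm ε).Compl

namespace SoftTorus

instance (ε : ℝ) : CStarAlgebra (SoftTorus ε) := inferInstanceAs (CStarAlgebra (softSeminorm ε).Compl)

/-- The order of the `C*`-algebra `A_ε`: `x ≤ y` if and only if `y - x` is selfadjoint with
nonnegative spectrum. -/
instance (ε : ℝ) : PartialOrder (SoftTorus ε) := CStarAlgebra.spectralOrder (SoftTorus ε)

instance (ε : ℝ) : StarOrderedRing (SoftTorus ε) := CStarAlgebra.spectralOrderedRing (SoftTorus ε)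

/-- The canonical ring homomorphism of the universal `*`-algebra of two unitaries into `A_ε`. -/
def coe (ε : ℝ) : TwoUnitaries →+* SoftTorus ε := (softSeminorm ε).coe

/-- The first canonical unitary generator. -/
def u (ε : ℝ) : SoftTorus ε := coe ε TwoUnitaries.u

/-- The second canonical unitary generator. -/
def v (ε : ℝ) : SoftTorus ε := coe ε TwoUnitaries.v

theorem star_coe (ε : ℝ) (x : TwoUnitaries) : star (coe ε x) = coe ε (star x) :=
  (softSeminorm ε).star_coe x

theorem norm_coe (ε : ℝ) (x : TwoUnitaries) : ‖coe ε x‖ = softSeminorm ε x :=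
  (softSeminorm ε).norm_coe x

theorem u_mem (ε : ℝ) : u ε ∈ unitary (SoftTorus ε) := by
  have h := Unitary.mem_iff.1 TwoUnitaries.u_mem
  rw [Unitary.mem_iff, u, star_coe, ← map_mul, ← map_mul, h.1, h.2, map_one]
  exact ⟨rfl, rfl⟩

theorem v_mem (ε : ℝ) : v ε ∈ unitary (SoftTorus ε) := by
  have h := Unitary.mem_iff.1 TwoUnitaries.v_mem
  rw [Unitary.mem_iff, v, star_coe, ← map_mul, ← map_mul, h.1, h.2, map_one]
  exact ⟨rfl, rfl⟩

theorem norm_commutator_le {ε : ℝ} (hε : 0 ≤ ε) : ‖u ε * v ε - v ε * u ε‖ ≤ ε := by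
  rw [u, v, ← map_mul, ← map_mul, ← map_sub, norm_coe]
  exact Real.iSup_le (fun p => p.2) hε

/-- The `*`-homomorphism out of `A_ε` determined by two unitaries `a`, `b` of a `C*`-algebra with
`‖a b - b a‖ ≤ ε`. -/
def lift {ε : ℝ} {B : Type*} [CStarAlgebra B] (a b : unitary B)
    (hab : ‖(a * b - b * a : B)‖ ≤ ε) : SoftTorus ε →⋆ₐ[ℂ] B :=
  (softSeminorm ε).lift (TwoUnitaries.lift a b) fun x =>
    le_iSup_softSeminorms (ε := ε) ⟨CStarSeminorm.ofHom (TwoUnitaries.lift a b), by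
      change ‖TwoUnitaries.lift a b _‖ ≤ ε
      rw [map_sub, map_mul, map_mul, TwoUnitaries.lift_u, TwoUnitaries.lift_v]
      exact hab⟩ x

theorem lift_coe {ε : ℝ} {B : Type*} [CStarAlgebra B] (a b : unitary B)
    (hab : ‖(a * b - b * a : B)‖ ≤ ε) (x : TwoUnitaries) :
    lift a b hab (coe ε x) = TwoUnitaries.lift a b x :=
  (softSeminorm ε).lift_coe _ _ x

theorem adjoin_dense (ε : ℝ) :
    (StarAlgebra.adjoin ℂ {u ε, v ε}).topologicalClosure = ⊤ := by
  have hu : u ε ∈ StarAlgebra.adjoin ℂ {u ε, v ε} := StarAlgebra.subset_adjoin _ _ (by simp)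
  have hv : v ε ∈ StarAlgebra.adjoin ℂ {u ε, v ε} := StarAlgebra.subset_adjoin _ _ (by simp)
  have hg (g : FreeGroup (Fin 2)) :
      coe ε (MonoidAlgebra.single g 1) ∈ StarAlgebra.adjoin ℂ {u ε, v ε} := by
    induction g using FreeGroup.induction_on with
    | C1 => rw [← MonoidAlgebra.one_def, map_one]; exact one_mem _
    | of i => fin_cases i; exacts [hu, hv]
    | inv_of i h =>
      have := star_mem h
      rwa [star_coe, groupAlgebra_star_single, star_one] at this
    | mul g h hg hh =>
      have := mul_mem hg hh
      rwa [← map_mul, MonoidAlgebra.single_mul_single, one_mul] at this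
  have hx (x : TwoUnitaries) : coe ε x ∈ StarAlgebra.adjoin ℂ {u ε, v ε} := by
    induction x using MonoidAlgebra.induction_linear with
    | zero => rw [map_zero]; exact zero_mem _
    | add x y hx hy => rw [map_add]; exact add_mem hx hy
    | single g c =>
      have h2 : MonoidAlgebra.single g c = c • MonoidAlgebra.single g (1 : ℂ) := by
        simp [MonoidAlgebra.smul_single]
      have h3 : coe ε (c • MonoidAlgebra.single g (1 : ℂ)) =
        c • coe ε (MonoidAlgebra.single g (1 : ℂ)) := (softSeminorm ε).coe_smul c _
      rw [h2, h3]
      exact SMulMemClass.smul_mem c (hg g)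
  rw [eq_top_iff]
  rintro x -
  have : x ∈ closure (Set.range (coe ε)) := (softSeminorm ε).denseRange_coe x
  exact closure_mono (by rintro _ ⟨y, rfl⟩; exact hx y) this

/-- The universal property of `A_ε`. -/
theorem existsUnique_lift {ε : ℝ} {B : Type*} [CStarAlgebra B] {a b : B}
    (ha : a ∈ unitary B) (hb : b ∈ unitary B) (hab : ‖a * b - b * a‖ ≤ ε) :
    ∃! φ : SoftTorus ε →⋆ₐ[ℂ] B, φ (u ε) = a ∧ φ (v ε) = b := by
  refine ⟨lift ⟨a, ha⟩ ⟨b, hb⟩ hab, ⟨?_, ?_⟩, ?_⟩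
  · rw [u, lift_coe, TwoUnitaries.lift_u]
  · rw [v, lift_coe, TwoUnitaries.lift_v]
  · rintro ψ ⟨h1, h2⟩
    have hu : lift ⟨a, ha⟩ ⟨b, hb⟩ hab (u ε) = a := by rw [u, lift_coe, TwoUnitaries.lift_u]
    have hv : lift ⟨a, ha⟩ ⟨b, hb⟩ hab (v ε) = b := by rw [v, lift_coe, TwoUnitaries.lift_v]
    have hle : (StarAlgebra.adjoin ℂ {u ε, v ε}) ≤
        StarAlgHom.equalizer ψ (lift ⟨a, ha⟩ ⟨b, hb⟩ hab) :=
      StarAlgebra.adjoin_le (by rintro x (rfl | rfl) <;> simp [*])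
    ext x
    have hx : x ∈ closure ((StarAlgebra.adjoin ℂ {u ε, v ε} : StarSubalgebra ℂ (SoftTorus ε)) :
        Set (SoftTorus ε)) := by
      have : x ∈ (StarAlgebra.adjoin ℂ {u ε, v ε}).topologicalClosure := by
        rw [adjoin_dense]; trivial
      exact this
    have hcont (φ : SoftTorus ε →⋆ₐ[ℂ] B) : Continuous φ :=
      AddMonoidHomClass.continuous_of_bound φ 1 fun y => by
        rw [one_mul]; exact NonUnitalStarAlgHom.norm_apply_le φ y
    exact closure_minimal (t := {x | ψ x = lift ⟨a, ha⟩ ⟨b, hb⟩ hab x}) (fun y hy => hle hy)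
      (isClosed_eq (hcont ψ) (hcont _)) hx

end SoftTorus

/-! ### Tracial states and hyponormal elements -/

/-- The linear functional `τ` on the unital `C*`-algebra `A` is a faithful tracial state: it is
positive, unital, a trace, and vanishes on `x^* x` only if `x = 0`. -/
structure IsFaithfulTracialState {A : Type*} [CStarAlgebra A] (τ : A →ₗ[ℂ] ℂ) : Prop where
  nonneg : ∀ x : A, 0 ≤ τ (star x * x)
  map_one : τ 1 = 1
  map_mul_comm : ∀ x y : A, τ (x * y) = τ (y * x)
  faithful : ∀ x : A, τ (star x * x) = 0 → x = 0

/-- `x` is hyponormal if `x^* x ≥ x x^*`. -/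
def IsHyponormal {A : Type*} [CStarAlgebra A] [PartialOrder A] (x : A) : Prop :=
  x * star x ≤ star x * x

end

/-! A faithful trace kills hyponormality: if `x^*x - xx^* = y^*y`, the trace of the left side is
zero, so `y = 0`. To build the trace it suffices to find countably many finite-dimensional
representations of `A_ε` that together are faithful, and to sum their normalized traces with
positive weights.

Such representations come from unrolling one unitary along the other. Let `U`, `V` be unitaries on a
Hilbert space with `‖UV - VU‖ ≤ ε`. The conjugates `U_n = V⁻ⁿ U Vⁿ` form a sequence with steps of
norm at most `ε`. Such a sequence can be compressed to a finite-dimensional `K` as a sequence of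
unitaries `w_n` with the same step bound (`exists_chain_compression`); the compression of one step
uses the Cayley transform. Placing `w_0, …, w_l, w_l, …, w_0` on the diagonal of a direct sum of
copies of `K`, next to the cyclic shift, gives a finite-dimensional pair with commutator at most `ε`
(`norm_commutator_fold_le`).

On the vector `(V⁻ⁱ ξ)_i`, a polynomial `y` in the generators and their adjoints acts blockwise as
`(V⁻ⁱ yξ)_i`, except within a bounded distance of the ends (`FoldsTo.all`). Comparing norms for
large `l` gives `‖yξ‖ ≤ 2 ‖y‖ ‖ξ‖` with `‖y‖` taken in the finite-dimensional representation
(`exists_finiteDimensional_approx`). With `ξ` a norming vector from the GNS construction, these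
representations see every `y` up to the factor 2, which is enough for a faithful trace by density.
-/

noncomputable section

open scoped ComplexOrder

/-! ### Unitary compressions to finite-dimensional subspaces. -/

section Compression

open scoped InnerProductSpace

variable {H : Type*} [NormedAddCommGroup H] [InnerProductSpace ℂ H]

/-- A unitary operator has a unitary compression to a finite-dimensional subspace `K`, agreeing
with it on all vectors of `K` that it maps into `K`. -/
theorem exists_unitary_compression (w : H ≃ₗᵢ[ℂ] H) (K : Submodule ℂ H) [FiniteDimensional ℂ K] :
    ∃ w' : K ≃ₗᵢ[ℂ] K, ∀ x : K, w x ∈ K → (w' x : H) = w x := by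
  -- `S` consists of the vectors of `K` that `w` keeps in `K`. An isometry from `S` into `K` extends
  -- to `K`, and an isometry of a finite-dimensional space into itself is onto.
  let S : Submodule ℂ K := (K.comap (w.toLinearEquiv : H →ₗ[ℂ] H)).comap K.subtype
  let L : S →ₗᵢ[ℂ] K :=
    { toLinearMap := LinearMap.codRestrict K
        ((w.toLinearEquiv : H →ₗ[ℂ] H) ∘ₗ K.subtype ∘ₗ S.subtype) fun x => x.2
      norm_map' := fun x => w.norm_map x }
  refine ⟨L.extend.toLinearIsometryEquiv rfl, fun x hx => ?_⟩
  have := L.extend_apply ⟨x, hx⟩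
  exact congrArg Subtype.val this

theorem norm_add_sq_of_re_inner_eq_zero {x y : H} (h : (⟪y, x⟫_ℂ).re = 0) :
    ‖x + y‖ ^ 2 = ‖x‖ ^ 2 + ‖y‖ ^ 2 := by
  rw [add_comm x y, norm_add_sq (𝕜 := ℂ)]
  simp only [RCLike.re_eq_complex_re, h]
  ring

theorem norm_sub_sq_of_re_inner_eq_zero {x y : H} (h : (⟪y, x⟫_ℂ).re = 0) :
    ‖x - y‖ ^ 2 = ‖x‖ ^ 2 + ‖y‖ ^ 2 := by
  rw [← norm_neg, neg_sub, norm_sub_sq (𝕜 := ℂ)]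
  simp only [RCLike.re_eq_complex_re, h]
  ring

/-- The Cayley transform of a skew-adjoint operator on a finite-dimensional space. -/
theorem exists_cayley {K : Type*} [NormedAddCommGroup K] [InnerProductSpace ℂ K]
    [FiniteDimensional ℂ K] (s : K →ₗ[ℂ] K) (hs : ∀ x, (⟪s x, x⟫_ℂ).re = 0) :
    ∃ w : K ≃ₗᵢ[ℂ] K, (∀ x, w (x - s x) = x + s x) ∧ ∀ y, ∃ x, y = x - s x := by
  -- Since `s x` is orthogonal to `x` in the real sense, `‖x - s x‖ = ‖x + s x‖ ≥ ‖x‖`. Hence `1 -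
  -- s` is invertible and `(1 + s)(1 - s)⁻¹` is isometric.
  have hinj : Function.Injective (1 - s : K →ₗ[ℂ] K) := by
    rw [← LinearMap.ker_eq_bot, LinearMap.ker_eq_bot']
    intro x hx
    have h1 := norm_sub_sq_of_re_inner_eq_zero (hs x)
    have h2 : x - s x = 0 := hx
    rw [h2, norm_zero] at h1
    have : ‖x‖ ^ 2 = 0 := by nlinarith [sq_nonneg ‖x‖, sq_nonneg ‖s x‖]
    simpa using this
  let e : K ≃ₗ[ℂ] K := LinearEquiv.ofInjectiveEndo (1 - s) hinj
  have he (x : K) : e x = x - s x := rfl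
  have hsurj (y : K) : ∃ x, y = x - s x := ⟨e.symm y, by rw [← he, e.apply_symm_apply]⟩
  let w : K →ₗᵢ[ℂ] K :=
    { toLinearMap := (1 + s) ∘ₗ (e.symm : K →ₗ[ℂ] K)
      norm_map' := fun y => by
        obtain ⟨x, rfl⟩ := hsurj y
        have h1 : ((1 + s) ∘ₗ (e.symm : K →ₗ[ℂ] K)) (x - s x) = x + s x := by
          simp [← he]
        rw [h1, ← sq_eq_sq₀ (norm_nonneg _) (norm_nonneg _),
          norm_add_sq_of_re_inner_eq_zero (hs x), norm_sub_sq_of_re_inner_eq_zero (hs x)] }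
  refine ⟨w.toLinearIsometryEquiv rfl, fun x => ?_, hsurj⟩
  change (1 + s) (e.symm (x - s x)) = _
  rw [← he, e.symm_apply_apply]
  rfl

/-- For `ε < 2` the operator `1 + w` is invertible, so `w` is the Cayley transform of the
skew-adjoint `s = (w - 1)(w + 1)⁻¹`. Skew-adjointness survives compression to `K`, unlike unitarity,
and the Cayley transform of the compressed `s` is `w'`. -/
theorem exists_compression_near_one_of_lt_two [CompleteSpace H] {ε : ℝ} (hε : 0 ≤ ε) (hε2 : ε < 2)
    (w : H ≃ₗᵢ[ℂ] H) (hw : ∀ x, ‖w x - x‖ ≤ ε * ‖x‖) (K : Submodule ℂ H)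
    [FiniteDimensional ℂ K] :
    ∃ w' : K ≃ₗᵢ[ℂ] K, (∀ x, ‖w' x - x‖ ≤ ε * ‖x‖) ∧ ∀ x : K, w x ∈ K → (w' x : H) = w x := by
  let W : H →L[ℂ] H := (w : H →L[ℂ] H)
  have hW (x : H) : W x = w x := rfl
  have hnorm : ‖(1 / 2 : ℂ) • (1 - W)‖ < 1 := by
    have h1 : ‖1 - W‖ ≤ ε := ContinuousLinearMap.opNorm_le_bound _ hε fun x => by
      rw [sub_apply, norm_sub_rev]; exact hw x
    rw [norm_smul]
    norm_num
    linarith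
  obtain ⟨M, hM⟩ := isUnit_one_sub_of_norm_lt_one hnorm
  let N : H →L[ℂ] H := ↑M⁻¹
  have hMx (x : H) : (M : H →L[ℂ] H) x = (1 / 2 : ℂ) • (w x + x) := by
    rw [hM]
    simp only [sub_apply, smul_apply, one_apply_eq_self, hW]
    module
  have hMN (x : H) : (1 / 2 : ℂ) • (w (N x) + N x) = x := by
    rw [← hMx]
    exact congr($(M.mul_inv) x)
  have hNM (x : H) : N ((1 / 2 : ℂ) • (w x + x)) = x := by
    rw [← hMx]
    exact congr($(M.inv_mul) x)
  let s : H →L[ℂ] H := (1 / 2 : ℂ) • ((W - 1) * N)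
  have hs_apply (x : H) : s x = (1 / 2 : ℂ) • (w (N x) - N x) := rfl
  have hadd (x : H) : x + s x = w (N x) := by
    rw [hs_apply]; nth_rewrite 1 [← hMN x]; module
  have hsub (x : H) : x - s x = N x := by
    rw [hs_apply]; nth_rewrite 1 [← hMN x]; module
  have hre (x : H) : (⟪s x, x⟫_ℂ).re = 0 := by
    have h : ‖x + s x‖ ^ 2 = ‖x - s x‖ ^ 2 := by rw [hadd, hsub, w.norm_map]
    rw [norm_add_sq (𝕜 := ℂ), norm_sub_sq (𝕜 := ℂ), inner_re_symm] at h
    simp only [RCLike.re_eq_complex_re] at h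
    linarith
  -- The bound `‖w - 1‖ ≤ ε` says `2‖s x‖ ≤ ε ‖x - s x‖`, and `‖x - s x‖² = ‖x‖² + ‖s x‖²`. In this
  -- form it passes to the compression, because projecting only shrinks `s x` and `4 - ε² ≥ 0`.
  have hbd (x : H) : (4 - ε ^ 2) * ‖s x‖ ^ 2 ≤ ε ^ 2 * ‖x‖ ^ 2 := by
    have h1 := hw (N x)
    have h2 : w (N x) - N x = (2 : ℂ) • s x := by rw [hs_apply, smul_smul]; norm_num
    have h3 := norm_sub_sq_of_re_inner_eq_zero (hre x)
    rw [hsub] at h3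
    rw [h2, norm_smul, Complex.norm_ofNat] at h1
    have h4 : (2 * ‖s x‖) ^ 2 ≤ (ε * ‖N x‖) ^ 2 := by gcongr
    rw [mul_pow ε, h3] at h4
    nlinarith
  let sK : K →ₗ[ℂ] K := (K.orthogonalProjectionOnto : H →ₗ[ℂ] K) ∘ₗ (s : H →ₗ[ℂ] H) ∘ₗ K.subtype
  have hsK (x : K) : sK x = K.orthogonalProjectionOnto (s x) := rfl
  have hreK (x : K) : (⟪sK x, x⟫_ℂ).re = 0 := by
    rw [hsK, Submodule.inner_orthogonalProjectionOnto_eq_of_mem_right, hre]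
  obtain ⟨w', hw', hsurj⟩ := exists_cayley sK hreK
  refine ⟨w', fun y => ?_, fun y hy => ?_⟩
  · obtain ⟨x, rfl⟩ := hsurj y
    have h1 : w' (x - sK x) - (x - sK x) = (2 : ℂ) • sK x := by rw [hw']; module
    have h2 := norm_sub_sq_of_re_inner_eq_zero (hreK x)
    have h3 : ‖sK x‖ ≤ ‖s x‖ := K.norm_orthogonalProjectionOnto_apply_le _
    have h4 := hbd x
    rw [h1, norm_smul, Complex.norm_ofNat]
    rw [← sq_le_sq₀ (by positivity) (by positivity), mul_pow ε, h2]
    have h5 : (4 - ε ^ 2) * ‖sK x‖ ^ 2 ≤ (4 - ε ^ 2) * ‖s x‖ ^ 2 := by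
      have : 0 ≤ 4 - ε ^ 2 := by nlinarith
      gcongr
    rw [Submodule.coe_norm x]
    nlinarith
  -- This `x` solves `x - s x = y` and `x + s x = w y`. As `w y` lies in `K`, so do `x` and `s x`,
  -- and the projection leaves `s x` unchanged.
  · let x : K := (1 / 2 : ℂ) • (⟨w y, hy⟩ + y)
    have hx : (x : H) = (1 / 2 : ℂ) • (w y + y) := rfl
    have hsx : s x = (1 / 2 : ℂ) • (w y - y) := by rw [hs_apply, hx, hNM]
    have hsKx : sK x = (1 / 2 : ℂ) • (⟨w y, hy⟩ - y) := by
      rw [hsK, hsx]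
      exact K.orthogonalProjectionOnto_mem_subspace_eq_self ((1 / 2 : ℂ) • (⟨w y, hy⟩ - y) : K)
    have h1 : x - sK x = y := by rw [hsKx]; simp only [x]; module
    have h2 : x + sK x = ⟨w y, hy⟩ := by rw [hsKx]; simp only [x]; module
    have := hw' x
    rw [h1, h2] at this
    rw [this]

/-- A unitary operator within `ε` of the identity has a unitary compression to a
finite-dimensional subspace `K` that is within `ε` of the identity and agrees with it on all
vectors of `K` that it maps into `K`. -/
theorem exists_compression_near_one [CompleteSpace H] {ε : ℝ} (hε : 0 ≤ ε)
    (w : H ≃ₗᵢ[ℂ] H) (hw : ∀ x, ‖w x - x‖ ≤ ε * ‖x‖) (K : Submodule ℂ H)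
    [FiniteDimensional ℂ K] :
    ∃ w' : K ≃ₗᵢ[ℂ] K, (∀ x, ‖w' x - x‖ ≤ ε * ‖x‖) ∧ ∀ x : K, w x ∈ K → (w' x : H) = w x := by
  rcases lt_or_ge ε 2 with h | h
  · exact exists_compression_near_one_of_lt_two hε h w hw K
  · obtain ⟨w', hw'⟩ := exists_unitary_compression w K
    refine ⟨w', fun x => ?_, hw'⟩
    calc ‖w' x - x‖ ≤ ‖w' x‖ + ‖x‖ := norm_sub_le _ _
      _ = 2 * ‖x‖ := by rw [w'.norm_map]; ring
      _ ≤ ε * ‖x‖ := by gcongr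

/-- Simultaneous compression of a sequence of unitary operators with steps of norm at most `ε`. -/
theorem exists_chain_compression [CompleteSpace H] {ε : ℝ} (hε : 0 ≤ ε)
    (u : ℕ → H ≃ₗᵢ[ℂ] H) (hu : ∀ n x, ‖u (n + 1) x - u n x‖ ≤ ε * ‖x‖) (K : Submodule ℂ H)
    [FiniteDimensional ℂ K] :
    ∃ w : ℕ → K ≃ₗᵢ[ℂ] K, (∀ n x, ‖w (n + 1) x - w n x‖ ≤ ε * ‖x‖) ∧
      ∀ n (x : K), (∀ m ≤ n, u m x ∈ K) → (w n x : H) = u n x := by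
  obtain ⟨w₀, hw₀⟩ := exists_unitary_compression (u 0) K
  have hc (n : ℕ) (x : H) : ‖((u n).symm.trans (u (n + 1))) x - x‖ ≤ ε * ‖x‖ := by
    simpa using hu n ((u n).symm x)
  choose c hc1 hc2 using fun n => exists_compression_near_one hε _ (hc n) K
  -- With `c n` a compression of `u (n + 1) (u n)⁻¹`, put `w (n + 1) = c n ∘ w n`. Agreement at
  -- stage `n` requires all earlier images `u m x` to lie in `K`, since the product passes through
  -- each of them.
  refine ⟨fun n => Nat.rec w₀ (fun n w => w.trans (c n)) n, fun n x => ?_, fun n => ?_⟩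
  · simpa using hc1 n (Nat.rec (motive := fun _ => K ≃ₗᵢ[ℂ] K) w₀ (fun n w => w.trans (c n)) n x)
  · induction n with
    | zero => exact fun x hx => hw₀ x (hx 0 le_rfl)
    | succ n ih =>
      intro x hx
      have h1 := ih x fun m hm => hx m (by omega)
      have h2 := hc2 n _ (show ((u n).symm.trans (u (n + 1)))
        (Nat.rec (motive := fun _ => K ≃ₗᵢ[ℂ] K) w₀ (fun n w => w.trans (c n)) n x : K) ∈ K by
          rw [h1]; simpa using hx (n + 1) le_rfl)
      rw [h1] at h2
      simpa using h2

end Compression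

/-! ### Unrolling `U` along `V` and folding the result into a finite-dimensional pair. -/

section Unroll

variable {H : Type*} [NormedAddCommGroup H] [InnerProductSpace ℂ H]

/-- The operators `V⁻ⁿ U Vⁿ`. -/
def conjSeq (U V : H ≃ₗᵢ[ℂ] H) (n : ℕ) : H ≃ₗᵢ[ℂ] H := V⁻¹ ^ n * U * (V⁻¹ ^ n)⁻¹

theorem conjSeq_pow_apply (U V : H ≃ₗᵢ[ℂ] H) (n : ℕ) (x : H) :
    conjSeq U V n ((V⁻¹ ^ n) x) = (V⁻¹ ^ n) (U x) := by
  change (V⁻¹ ^ n) (U ((V⁻¹ ^ n).symm ((V⁻¹ ^ n) x))) = _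
  rw [LinearIsometryEquiv.symm_apply_apply]

theorem inv_pow_succ_apply (V : H ≃ₗᵢ[ℂ] H) (n : ℕ) (x : H) :
    (V⁻¹ ^ (n + 1)) (V x) = (V⁻¹ ^ n) x := by
  rw [pow_succ]
  exact congrArg (V⁻¹ ^ n) (V.symm_apply_apply x)

/-- On a vector `V⁻ⁿ y` the difference equals `V⁻⁽ⁿ⁺¹⁾ (UV - VU) y`. -/
theorem norm_conjSeq_succ_sub_le {ε : ℝ} {U V : H ≃ₗᵢ[ℂ] H}
    (hUV : ∀ x, ‖U (V x) - V (U x)‖ ≤ ε * ‖x‖) (n : ℕ) (x : H) :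
    ‖conjSeq U V (n + 1) x - conjSeq U V n x‖ ≤ ε * ‖x‖ := by
  obtain ⟨y, rfl⟩ := (V⁻¹ ^ n).surjective x
  rw [conjSeq_pow_apply]
  nth_rewrite 1 [← inv_pow_succ_apply]
  rw [conjSeq_pow_apply, ← inv_pow_succ_apply V n (U y), ← map_sub]
  simpa only [LinearIsometryEquiv.norm_map] using hUV y

/-- The index map `0, 1, …, l, l, …, 1, 0`. -/
def foldIndex (l : ℕ) (i : Fin (2 * l + 2)) : ℕ := min i (2 * l + 1 - i)

theorem foldIndex_of_le {l : ℕ} {i : Fin (2 * l + 2)} (h : (i : ℕ) ≤ l) : foldIndex l i = i := by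
  unfold foldIndex; omega

/-- Going up and then down makes cyclically adjacent indices differ by at most one, even at the
wrap-around and at the repeated `l`; this is why the sequence is folded rather than closed up
directly. -/
theorem foldIndex_finRotate (l : ℕ) (i : Fin (2 * l + 2)) :
    foldIndex l (finRotate _ i) = foldIndex l i ∨
      foldIndex l (finRotate _ i) = foldIndex l i + 1 ∨
      foldIndex l i = foldIndex l (finRotate _ i) + 1 := by
  have h := coe_finRotate (n := 2 * l + 1) i
  have h2 : i = Fin.last (2 * l + 1) ↔ (i : ℕ) = 2 * l + 1 := Fin.ext_iff
  have h3 := i.2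
  simp only [foldIndex]
  change ((finRotate (2 * l + 2) i : Fin _) : ℕ) = _ at h
  split_ifs at h with h4
  · have := h2.1 h4
    omega
  · have : (i : ℕ) ≠ 2 * l + 1 := fun h => h4 (h2.2 h)
    omega

/-- The representation of the universal `*`-algebra of two unitaries on a Hilbert space determined
by two unitary operators. -/
def TwoUnitaries.rep {E : Type*} [NormedAddCommGroup E] [InnerProductSpace ℂ E] [CompleteSpace E]
    (a b : E ≃ₗᵢ[ℂ] E) : TwoUnitaries →⋆ₐ[ℂ] (E →L[ℂ] E) :=
  TwoUnitaries.lift (Unitary.linearIsometryEquiv.symm a) (Unitary.linearIsometryEquiv.symm b)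

section Rep

variable {E : Type*} [NormedAddCommGroup E] [InnerProductSpace ℂ E] [CompleteSpace E]
  (a b : E ≃ₗᵢ[ℂ] E)

theorem TwoUnitaries.rep_u (x : E) : rep a b u x = a x := by
  rw [rep, lift_u]; rfl

theorem TwoUnitaries.rep_v (x : E) : rep a b v x = b x := by
  rw [rep, lift_v]; rfl

theorem TwoUnitaries.rep_star_u (x : E) : rep a b (star u) x = a.symm x := by
  rw [← a.symm_apply_apply (rep a b (star u) x), ← rep_u a b]
  change a.symm ((rep a b u * rep a b (star u)) x) = _
  rw [← map_mul, (Unitary.mem_iff.1 u_mem).2, map_one]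
  rfl

theorem TwoUnitaries.rep_star_v (x : E) : rep a b (star v) x = b.symm x := by
  rw [← b.symm_apply_apply (rep a b (star v) x), ← rep_v a b]
  change b.symm ((rep a b v * rep a b (star v)) x) = _
  rw [← map_mul, (Unitary.mem_iff.1 v_mem).2, map_one]
  rfl

theorem TwoUnitaries.rep_mul (y z : TwoUnitaries) (x : E) :
    rep a b (y * z) x = rep a b y (rep a b z x) := by
  rw [map_mul]; rfl

theorem TwoUnitaries.rep_add (y z : TwoUnitaries) (x : E) :
    rep a b (y + z) x = rep a b y x + rep a b z x := by
  rw [map_add]; rfl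

theorem TwoUnitaries.rep_smul (c : ℂ) (y : TwoUnitaries) (x : E) :
    rep a b (c • y) x = c • rep a b y x := by
  rw [map_smul]; rfl

theorem TwoUnitaries.rep_one (x : E) : rep a b 1 x = x := by
  rw [map_one]; rfl

theorem TwoUnitaries.rep_zero (x : E) : rep a b 0 x = 0 := by
  rw [map_zero]; rfl

end Rep

variable {K : Type*} [NormedAddCommGroup K] [InnerProductSpace ℂ K]

/-- The direct sum of `2 l + 2` copies of `K`. -/
abbrev FoldSpace (K : Type*) [NormedAddCommGroup K] [InnerProductSpace ℂ K] (l : ℕ) : Type _ :=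
  PiLp 2 (fun _ : Fin (2 * l + 2) => K)

/-- The block-diagonal unitary with blocks `w 0, …, w l, w l, …, w 0`. -/
def foldDiag (w : ℕ → K ≃ₗᵢ[ℂ] K) (l : ℕ) : FoldSpace K l ≃ₗᵢ[ℂ] FoldSpace K l :=
  LinearIsometryEquiv.piLpCongrRight 2 fun i => w (foldIndex l i)

variable (K) in
/-- The cyclic shift of `2 l + 2` copies of `K`. -/
def foldShift (l : ℕ) : FoldSpace K l ≃ₗᵢ[ℂ] FoldSpace K l :=
  LinearIsometryEquiv.piLpCongrLeft 2 ℂ K (finRotate _)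

theorem foldDiag_apply (w : ℕ → K ≃ₗᵢ[ℂ] K) (l : ℕ) (f : FoldSpace K l)
    (i : Fin (2 * l + 2)) : foldDiag w l f i = w (foldIndex l i) (f i) := rfl

theorem foldDiag_symm_apply (w : ℕ → K ≃ₗᵢ[ℂ] K) (l : ℕ) (f : FoldSpace K l)
    (i : Fin (2 * l + 2)) : (foldDiag w l).symm f i = (w (foldIndex l i)).symm (f i) := rfl

theorem foldShift_apply (l : ℕ) (f : FoldSpace K l)
    (i : Fin (2 * l + 2)) : foldShift K l f (finRotate _ i) = f i := by
  rw [foldShift, LinearIsometryEquiv.piLpCongrLeft_apply]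
  simp [Equiv.piCongrLeft']

theorem foldShift_symm_apply (l : ℕ) (f : FoldSpace K l)
    (i : Fin (2 * l + 2)) : (foldShift K l).symm f i = f (finRotate _ i) := by
  rw [← foldShift_apply, LinearIsometryEquiv.apply_symm_apply]

/-- In block `i + 1` (taken cyclically) the commutator is the difference of two neighbouring `w`'s
applied to `f i`. -/
theorem norm_commutator_fold_le {ε : ℝ} (hε : 0 ≤ ε) {w : ℕ → K ≃ₗᵢ[ℂ] K}
    (hw : ∀ n x, ‖w (n + 1) x - w n x‖ ≤ ε * ‖x‖) (l : ℕ) (f : FoldSpace K l) :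
    ‖foldDiag w l (foldShift K l f) - foldShift K l (foldDiag w l f)‖ ≤ ε * ‖f‖ := by
  rw [← sq_le_sq₀ (norm_nonneg _) (by positivity), mul_pow, PiLp.norm_sq_eq_of_L2,
    PiLp.norm_sq_eq_of_L2, Finset.mul_sum, ← Equiv.sum_comp (finRotate (2 * l + 2))]
  refine Finset.sum_le_sum fun i _ => ?_
  rw [PiLp.sub_apply, foldShift_apply, foldDiag_apply, foldDiag_apply, foldShift_apply, ← mul_pow]
  gcongr
  rcases foldIndex_finRotate l i with h | h | h
  · rw [h, sub_self, norm_zero]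
    positivity
  · rw [h]; exact hw _ _
  · rw [h, norm_sub_rev]; exact hw _ _

variable [CompleteSpace H]

/-- The action of `y` on the vector `(V⁻ⁱ η)ᵢ` in a folded compression of the pair `U`, `V` to a
sufficiently large finite-dimensional subspace is `(V⁻ⁱ y η)ᵢ`, up to boundary terms. -/
def FoldsTo (U V : H ≃ₗᵢ[ℂ] H) (y : TwoUnitaries) : Prop :=
  ∃ d : ℕ, ∀ (l : ℕ) (η : H), ∃ S : Set H, S.Finite ∧
    ∀ (K : Submodule ℂ H) [CompleteSpace K] (w : ℕ → K ≃ₗᵢ[ℂ] K),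
      (∀ n (x : K), (∀ m ≤ n, conjSeq U V m x ∈ K) → (w n x : H) = conjSeq U V n x) → S ⊆ K →
      ∀ (f : FoldSpace K l) (k : ℕ),
        (∀ i : Fin (2 * l + 2), k ≤ i → i + k ≤ l → (f i : H) = (V⁻¹ ^ (i : ℕ)) η) →
        ∀ i : Fin (2 * l + 2), k + d ≤ i → i + (k + d) ≤ l →
          (TwoUnitaries.rep (foldDiag w l) (foldShift K l) y f i : H) =
            (V⁻¹ ^ (i : ℕ)) (TwoUnitaries.rep U V y η)

namespace FoldsTo

variable {U V : H ≃ₗᵢ[ℂ] H}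

theorem one : FoldsTo U V 1 :=
  ⟨0, fun l η => ⟨∅, Set.finite_empty, fun K _ w _ _ f k hf i hi hi' => by
    rw [TwoUnitaries.rep_one, TwoUnitaries.rep_one]; exact hf i hi hi'⟩⟩

theorem zero : FoldsTo U V 0 :=
  ⟨0, fun l η => ⟨∅, Set.finite_empty, fun K _ w _ _ f k hf i hi hi' => by
    rw [TwoUnitaries.rep_zero, TwoUnitaries.rep_zero]; simp⟩⟩

theorem smul (c : ℂ) {y : TwoUnitaries} (hy : FoldsTo U V y) : FoldsTo U V (c • y) := by
  obtain ⟨d, h⟩ := hy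
  refine ⟨d, fun l η => ?_⟩
  obtain ⟨S, hS, h⟩ := h l η
  refine ⟨S, hS, fun K _ w hw hSK f k hf i hi hi' => ?_⟩
  have := h K w hw hSK f k hf i hi hi'
  rw [TwoUnitaries.rep_smul, TwoUnitaries.rep_smul, PiLp.smul_apply, Submodule.coe_smul, this,
    map_smul]

theorem add {y z : TwoUnitaries} (hy : FoldsTo U V y) (hz : FoldsTo U V z) :
    FoldsTo U V (y + z) := by
  obtain ⟨d, h⟩ := hy
  obtain ⟨e, h'⟩ := hz
  refine ⟨d + e, fun l η => ?_⟩
  obtain ⟨S, hS, h⟩ := h l η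
  obtain ⟨T, hT, h'⟩ := h' l η
  refine ⟨S ∪ T, hS.union hT, fun K _ w hw hSK f k hf i hi hi' => ?_⟩
  have h1 := h K w hw (Set.subset_union_left.trans hSK) f k hf i (by omega) (by omega)
  have h2 := h' K w hw (Set.subset_union_right.trans hSK) f k hf i (by omega) (by omega)
  rw [TwoUnitaries.rep_add, TwoUnitaries.rep_add, PiLp.add_apply, Submodule.coe_add, h1, h2,
    map_add]

/-- The margin `k` in `FoldsTo` is there for this step: the output of `z` is correct only with
margin `k + e`, and `y` must accept it as input. The margins then add up. -/
theorem mul {y z : TwoUnitaries} (hy : FoldsTo U V y) (hz : FoldsTo U V z) :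
    FoldsTo U V (y * z) := by
  obtain ⟨d, h⟩ := hy
  obtain ⟨e, h'⟩ := hz
  refine ⟨e + d, fun l η => ?_⟩
  obtain ⟨T, hT, h'⟩ := h' l η
  obtain ⟨S, hS, h⟩ := h l (TwoUnitaries.rep U V z η)
  refine ⟨S ∪ T, hS.union hT, fun K _ w hw hSK f k hf i hi hi' => ?_⟩
  have h2 := h' K w hw (Set.subset_union_right.trans hSK) f k hf
  have h1 := h K w hw (Set.subset_union_left.trans hSK) _ (k + e) h2 i (by omega) (by omega)
  rw [TwoUnitaries.rep_mul, TwoUnitaries.rep_mul]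
  exact h1

theorem finRotate_val {l : ℕ} {i : Fin (2 * l + 2)} (hi : (i : ℕ) ≤ l) :
    ((finRotate (2 * l + 2) i : Fin _) : ℕ) = i + 1 :=
  coe_finRotate_of_ne_last (n := 2 * l + 1) fun h => by
    have : (i : ℕ) = 2 * l + 1 := congrArg Fin.val h
    omega

/-- The finite set contains every `U_m V⁻ⁱ η` with `m, i ≤ l`, so `w i` agrees with `U_i` on `V⁻ⁱ
η`, and `U_i V⁻ⁱ = V⁻ⁱ U`. -/
theorem of_u : FoldsTo U V TwoUnitaries.u := by
  refine ⟨0, fun l η => ⟨(fun p : ℕ × ℕ => conjSeq U V p.1 ((V⁻¹ ^ p.2) η)) ''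
    (Set.Iic l ×ˢ Set.Iic l), ((Set.finite_Iic l).prod (Set.finite_Iic l)).image _,
    fun K _ w hw hSK f k hf i hi hi' => ?_⟩⟩
  have hil : (i : ℕ) ≤ l := by omega
  rw [TwoUnitaries.rep_u, TwoUnitaries.rep_u, foldDiag_apply, foldIndex_of_le hil]
  have hfi := hf i (by omega) (by omega)
  rw [hw i (f i) fun m hm => hSK ⟨(m, i), ⟨hm.trans hil, hil⟩, by rw [hfi]⟩, hfi,
    conjSeq_pow_apply]

/-- Here `V⁻ⁱ U⁻¹ η` itself must lie in `K`, so that `w i` can be seen to send it to `V⁻ⁱ η` and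
then be inverted. -/
theorem of_star_u : FoldsTo U V (star TwoUnitaries.u) := by
  refine ⟨0, fun l η => ⟨(fun n : ℕ => (V⁻¹ ^ n) (U.symm η)) '' Set.Iic l ∪
    (fun p : ℕ × ℕ => conjSeq U V p.1 ((V⁻¹ ^ p.2) (U.symm η))) ''
    (Set.Iic l ×ˢ Set.Iic l), ((Set.finite_Iic l).image _).union
      (((Set.finite_Iic l).prod (Set.finite_Iic l)).image _),
    fun K _ w hw hSK f k hf i hi hi' => ?_⟩⟩
  have hil : (i : ℕ) ≤ l := by omega
  have hfi := hf i (by omega) (by omega)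
  have hK : (V⁻¹ ^ (i : ℕ)) (U.symm η) ∈ K := hSK (.inl ⟨i, hil, rfl⟩)
  have h1 := hw i ⟨_, hK⟩ fun m hm => hSK (.inr ⟨(m, i), ⟨hm.trans hil, hil⟩, rfl⟩)
  rw [conjSeq_pow_apply, U.apply_symm_apply, ← hfi] at h1
  rw [TwoUnitaries.rep_star_u, TwoUnitaries.rep_star_u, foldDiag_symm_apply, foldIndex_of_le hil,
    ← Subtype.ext h1, LinearIsometryEquiv.symm_apply_apply]

/-- The shift puts `V⁻⁽ⁱ⁻¹⁾ η = V⁻ⁱ (V η)` in block `i`. One block at the boundary is lost. -/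
theorem of_v : FoldsTo U V TwoUnitaries.v := by
  refine ⟨1, fun l η => ⟨∅, Set.finite_empty, fun K _ w hw hSK f k hf i hi hi' => ?_⟩⟩
  rw [TwoUnitaries.rep_v, TwoUnitaries.rep_v]
  let j : Fin (2 * l + 2) := ⟨i - 1, by omega⟩
  have hj : (j : ℕ) = i - 1 := rfl
  have hji : finRotate _ j = i := by
    ext
    rw [finRotate_val (by omega)]
    omega
  have hi1 : (i : ℕ) = j + 1 := by omega
  rw [← hji, foldShift_apply, hf j (by omega) (by omega), hji, hi1]
  exact (inv_pow_succ_apply V _ η).symm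

theorem of_star_v : FoldsTo U V (star TwoUnitaries.v) := by
  refine ⟨1, fun l η => ⟨∅, Set.finite_empty, fun K _ w hw hSK f k hf i hi hi' => ?_⟩⟩
  have hil : (i : ℕ) ≤ l := by omega
  have hv := finRotate_val hil
  rw [TwoUnitaries.rep_star_v, TwoUnitaries.rep_star_v, foldShift_symm_apply,
    hf _ (by omega) (by omega), hv, ← inv_pow_succ_apply V i (V.symm η), V.apply_symm_apply]

theorem of_single (g : FreeGroup (Fin 2)) : FoldsTo U V (MonoidAlgebra.single g 1) := by
  induction g using FreeGroup.induction_on with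
  | C1 => exact one
  | of i => fin_cases i; exacts [of_u, of_v]
  | inv_of i h =>
    have h1 : MonoidAlgebra.single (FreeGroup.of i)⁻¹ (1 : ℂ) =
        star (MonoidAlgebra.single (FreeGroup.of i) (1 : ℂ)) := by
      rw [groupAlgebra_star_single, star_one]
    rw [h1]
    fin_cases i
    exacts [of_star_u, of_star_v]
  | mul g h hg hh =>
    have := hg.mul hh
    rwa [MonoidAlgebra.single_mul_single, one_mul] at this

theorem all (y : TwoUnitaries) : FoldsTo U V y := by
  induction y using MonoidAlgebra.induction_linear with
  | zero => exact zero
  | add x y hx hy => exact hx.add hy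
  | single g c =>
    have h : MonoidAlgebra.single g c = c • MonoidAlgebra.single g (1 : ℂ) := by
      simp [MonoidAlgebra.smul_single]
    rw [h]
    exact (of_single g).smul c

end FoldsTo

/-- Two unitary operators `U`, `V` on a Hilbert space with `‖U V - V U‖ ≤ ε` are approximated by
finite-dimensional ones. -/
theorem exists_finiteDimensional_approx {H : Type} [NormedAddCommGroup H] [InnerProductSpace ℂ H]
    [CompleteSpace H] {ε : ℝ} (hε : 0 ≤ ε) {U V : H ≃ₗᵢ[ℂ] H}
    (hUV : ∀ x, ‖U (V x) - V (U x)‖ ≤ ε * ‖x‖) (y : TwoUnitaries) (ξ : H) :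
    ∃ (E : Type) (_ : NormedAddCommGroup E) (_ : InnerProductSpace ℂ E)
      (_ : FiniteDimensional ℂ E) (_ : CompleteSpace E) (a b : E ≃ₗᵢ[ℂ] E),
      (∀ x, ‖a (b x) - b (a x)‖ ≤ ε * ‖x‖) ∧
      ‖TwoUnitaries.rep U V y ξ‖ ≤ 2 * ‖TwoUnitaries.rep a b y‖ * ‖ξ‖ := by
  obtain ⟨d, h⟩ := FoldsTo.all (U := U) (V := V) y
  -- With `l = 4d` the action of `y` is correct on the `2d + 1` blocks `d ≤ i ≤ 3d`, while there are
  -- `8d + 2` blocks in all. The ratio is at most 4, whence the factor 2 after a square root.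
  obtain ⟨S, hS, h⟩ := h (4 * d) ξ
  let T : Set H := S ∪ (fun n : ℕ => (V⁻¹ ^ n) ξ) '' Set.Iic (4 * d)
  have hT : T.Finite := hS.union ((Set.finite_Iic _).image _)
  let K : Submodule ℂ H := Submodule.span ℂ T
  have hTK : T ⊆ K := Submodule.subset_span
  have : FiniteDimensional ℂ K := FiniteDimensional.span_of_finite ℂ hT
  have : CompleteSpace K := FiniteDimensional.complete ℂ K
  obtain ⟨w, hw, hwK⟩ := exists_chain_compression hε _ (norm_conjSeq_succ_sub_le hUV) K
  refine ⟨FoldSpace K (4 * d), inferInstance, inferInstance,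
    inferInstance, inferInstance, foldDiag w _, foldShift K _, norm_commutator_fold_le hε hw _, ?_⟩
  set R := TwoUnitaries.rep (foldDiag w (4 * d)) (foldShift K (4 * d)) y with hR
  set c := ‖TwoUnitaries.rep U V y ξ‖ with hc
  let f : FoldSpace K (4 * d) := WithLp.toLp 2 fun i =>
    if hi : (i : ℕ) ≤ 4 * d then ⟨(V⁻¹ ^ (i : ℕ)) ξ, hTK (.inr ⟨i, hi, rfl⟩)⟩ else 0
  have hf (i : Fin (2 * (4 * d) + 2)) (hi : (i : ℕ) ≤ 4 * d) : (f i : H) = (V⁻¹ ^ (i : ℕ)) ξ := by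
    simp [f, hi]
  have hfnorm : ‖f‖ ^ 2 ≤ (8 * d + 2) * ‖ξ‖ ^ 2 := by
    rw [PiLp.norm_sq_eq_of_L2]
    have h1 : ∀ i ∈ Finset.univ, ‖f i‖ ^ 2 ≤ ‖ξ‖ ^ 2 := fun i _ => by
      by_cases hi : (i : ℕ) ≤ 4 * d
      · rw [Submodule.coe_norm, hf i hi, LinearIsometryEquiv.norm_map]
      · simp [f, hi]
    refine (Finset.sum_le_card_nsmul _ _ _ h1).trans_eq ?_
    simp only [Finset.card_univ, Fintype.card_fin, nsmul_eq_mul]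
    push_cast
    ring
  have hRf : (2 * d + 1) * c ^ 2 ≤ ‖R f‖ ^ 2 := by
    rw [PiLp.norm_sq_eq_of_L2]
    let s : Finset (Fin (2 * (4 * d) + 2)) := Finset.Icc ⟨d, by omega⟩ ⟨3 * d, by omega⟩
    have hs : s.card = 2 * d + 1 := by simp only [s, Fin.card_Icc]; omega
    have h1 : ∀ i ∈ s, c ^ 2 ≤ ‖R f i‖ ^ 2 := fun i hi => by
      obtain ⟨hi1, hi2⟩ := Finset.mem_Icc.1 hi
      have hi1 : d ≤ (i : ℕ) := hi1
      have hi2 : (i : ℕ) ≤ 3 * d := hi2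
      rw [Submodule.coe_norm, h K w hwK (Set.subset_union_left.trans hTK) f 0
        (fun i _ hi => hf i (by omega)) i (by omega) (by omega), LinearIsometryEquiv.norm_map]
    calc (2 * d + 1) * c ^ 2 = s.card • c ^ 2 := by rw [hs, nsmul_eq_mul]; push_cast; ring
      _ ≤ ∑ i ∈ s, ‖R f i‖ ^ 2 := Finset.card_nsmul_le_sum _ _ _ h1
      _ ≤ _ := Finset.sum_le_univ_sum_of_nonneg fun i => by positivity
  have hle : ‖R f‖ ^ 2 ≤ ‖R‖ ^ 2 * ‖f‖ ^ 2 := by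
    rw [← mul_pow]
    gcongr
    exact R.le_opNorm f
  have h0 : 0 ≤ ‖R‖ ^ 2 * ‖ξ‖ ^ 2 := by positivity
  have h2 : ‖R‖ ^ 2 * ‖f‖ ^ 2 ≤ ‖R‖ ^ 2 * ((8 * d + 2) * ‖ξ‖ ^ 2) := by gcongr
  have h3 : c ^ 2 ≤ (2 * ‖R‖ * ‖ξ‖) ^ 2 := by
    have hd : (0 : ℝ) < 2 * d + 1 := by positivity
    refine le_of_mul_le_mul_left ?_ hd
    nlinarith
  exact (sq_le_sq₀ (norm_nonneg _) (by positivity)).1 h3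

end Unroll

/-! ### States attaining the norm of a positive element, and the GNS representation. -/

section State

variable {A : Type*} [CStarAlgebra A] [PartialOrder A] [StarOrderedRing A]

theorem norm_algebraMap_sub_le {a : A} (ha : 0 ≤ a) {r : ℝ} (har : ‖a‖ ≤ r) :
    ‖algebraMap ℝ A r - a‖ ≤ r := by
  have hr : 0 ≤ r := (norm_nonneg a).trans har
  have h1 : a ≤ algebraMap ℝ A r := (CStarAlgebra.norm_le_iff_le_algebraMap a hr ha).1 har
  exact (CStarAlgebra.norm_le_iff_le_algebraMap _ hr (sub_nonneg.2 h1)).2 (sub_le_self _ ha)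

/-- Take a norm-one functional `g` attaining the norm of `b = ‖a‖ + a`, which is at least `2‖a‖`.
Both `Re g(1) ≤ 1` and `Re g(a) ≤ ‖a‖` are then forced to be equalities. From `Re g(1) = 1` and
`‖‖c‖ - c‖ ≤ ‖c‖` follows `Re g(c) ≥ 0` for `c ≥ 0`, and the hermitian part of `g` is the state. -/
theorem exists_state_apply_eq_norm {a : A} (ha : 0 ≤ a) (ha0 : a ≠ 0) :
    ∃ f : A →ₚ[ℂ] ℂ, f 1 = 1 ∧ f a = ‖a‖ := by
  have hpos : 0 < ‖a‖ := norm_pos_iff.2 ha0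
  set b := algebraMap ℝ A ‖a‖ + a with hb
  have hab : a ≤ b := le_add_of_nonneg_left (algebraMap_nonneg A (norm_nonneg a))
  have hbs : b ≤ algebraMap ℝ A ‖b‖ :=
    (IsSelfAdjoint.of_nonneg (ha.trans hab)).le_algebraMap_norm_self
  have hr : ‖a‖ ≤ ‖b‖ := (CStarAlgebra.norm_le_iff_le_algebraMap a (norm_nonneg b) ha).2
    (hab.trans hbs)
  have hbn : 2 * ‖a‖ ≤ ‖b‖ := by
    have h1 : a ≤ algebraMap ℝ A (‖b‖ - ‖a‖) := by
      rw [map_sub, le_sub_iff_add_le']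
      exact hbs
    linarith [(CStarAlgebra.norm_le_iff_le_algebraMap a (sub_nonneg.2 hr) ha).2 h1]
  have : Nontrivial A := ⟨a, 0, ha0⟩
  obtain ⟨g, hg, hgb⟩ := exists_dual_vector ℂ b (hpos.trans_le hr).ne'
  have hle (x : A) : (g x).re ≤ ‖x‖ :=
    (Complex.re_le_norm _).trans (by simpa [hg] using g.le_opNorm x)
  have halg (r : ℝ) : (g (algebraMap ℝ A r)).re = r * (g 1).re := by
    rw [Algebra.algebraMap_eq_smul_one, ← Complex.coe_smul, map_smul, smul_eq_mul,
      Complex.re_ofReal_mul]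
  have hga := hle a
  have hg1 : (g 1).re = 1 := by
    have h1 : (g 1).re ≤ 1 := by simpa using hle 1
    have h2 := congrArg Complex.re hgb
    rw [hb, map_add, Complex.add_re, halg, ← hb] at h2
    simp only [Complex.coe_algebraMap, Complex.ofReal_re] at h2
    nlinarith
  have hga' : (g a).re = ‖a‖ := by
    have h2 := congrArg Complex.re hgb
    rw [hb, map_add, Complex.add_re, halg, hg1, ← hb] at h2
    simp only [Complex.coe_algebraMap, Complex.ofReal_re] at h2
    linarith
  have hgpos (c : A) (hc : 0 ≤ c) : 0 ≤ (g c).re := by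
    have h1 := (hle _).trans (norm_algebraMap_sub_le hc le_rfl)
    rw [map_sub, Complex.sub_re, halg, hg1] at h1
    linarith
  let f₀ : A →ₗ[ℂ] ℂ :=
    { toFun := fun x => (1 / 2 : ℂ) * (g x + star (g (star x)))
      map_add' := fun x y => by simp only [star_add, map_add]; ring
      map_smul' := fun c x => by
        simp only [star_smul, map_smul, smul_eq_mul, star_mul', star_star, RingHom.id_apply]
        ring }
  have hf₀ (b : A) (hb : 0 ≤ b) : f₀ b = ((g b).re : ℂ) := by
    change (1 / 2 : ℂ) * (g b + star (g (star b))) = _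
    rw [(IsSelfAdjoint.of_nonneg hb).star_eq]
    change (1 / 2 : ℂ) * (g b + (starRingEnd ℂ) (g b)) = _
    rw [Complex.add_conj]
    push_cast
    ring
  refine ⟨PositiveLinearMap.mk₀ f₀ fun b hb => ?_, ?_, ?_⟩
  · rw [hf₀ b hb]
    exact_mod_cast hgpos b hb
  · change f₀ 1 = 1
    rw [hf₀ 1 zero_le_one, hg1]
    simp
  · change f₀ a = _
    rw [hf₀ a ha, hga']

/-- Every element of a `C*`-algebra attains its norm at a unit vector in some representation. -/
theorem exists_representation_norm_eq {A : Type} [CStarAlgebra A] [PartialOrder A]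
    [StarOrderedRing A] {a : A} (ha : a ≠ 0) :
    ∃ (H : Type) (_ : NormedAddCommGroup H) (_ : InnerProductSpace ℂ H) (_ : CompleteSpace H)
      (π : A →⋆ₐ[ℂ] (H →L[ℂ] H)) (ξ : H), ‖ξ‖ = 1 ∧ ‖π a ξ‖ = ‖a‖ := by
  obtain ⟨f, hf1, hfa⟩ := exists_state_apply_eq_norm (star_mul_self_nonneg a)
    (by simpa using ha)
  refine ⟨f.GNS, inferInstance, inferInstance, inferInstance, f.gnsStarAlgHom,
    ((f.toPreGNS 1 : f.PreGNS) : f.GNS), ?_, ?_⟩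
  · rw [UniformSpace.Completion.norm_coe, PositiveLinearMap.preGNS_norm_def]
    simp [hf1]
  · change ‖f.gnsNonUnitalStarAlgHom a _‖ = _
    rw [PositiveLinearMap.gnsNonUnitalStarAlgHom_apply_coe, UniformSpace.Completion.norm_coe,
      PositiveLinearMap.preGNS_norm_def]
    simp [hfa, CStarRing.norm_star_mul_self]

end State

/-! ### The normalized trace in finite dimensions. -/

section Trace

variable {E : Type*} [NormedAddCommGroup E] [InnerProductSpace ℂ E]

variable (E) in
/-- The normalized trace on the operators on a finite-dimensional Hilbert space. -/
def normalizedTrace : (E →L[ℂ] E) →ₗ[ℂ] ℂ :=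
  (Module.finrank ℂ E : ℂ)⁻¹ • LinearMap.trace ℂ E ∘ₗ ContinuousLinearMap.coeLM ℂ

theorem normalizedTrace_apply (T : E →L[ℂ] E) :
    normalizedTrace E T = (Module.finrank ℂ E : ℂ)⁻¹ * LinearMap.trace ℂ E T := rfl

theorem normalizedTrace_mul_comm (S T : E →L[ℂ] E) :
    normalizedTrace E (S * T) = normalizedTrace E (T * S) := by
  rw [normalizedTrace_apply, normalizedTrace_apply]
  exact congrArg _ (LinearMap.trace_mul_comm ℂ (S : E →ₗ[ℂ] E) T)

theorem normalizedTrace_one [FiniteDimensional ℂ E] [Nontrivial E] : normalizedTrace E 1 = 1 := by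
  rw [normalizedTrace_apply]
  change _ * LinearMap.trace ℂ E 1 = 1
  rw [LinearMap.trace_one]
  exact inv_mul_cancel₀ (Nat.cast_ne_zero.2 Module.finrank_pos.ne')

variable [FiniteDimensional ℂ E]

theorem norm_normalizedTrace_le (T : E →L[ℂ] E) : ‖normalizedTrace E T‖ ≤ ‖T‖ := by
  have h : ‖LinearMap.trace ℂ E T‖ ≤ Module.finrank ℂ E * ‖T‖ := by
    rw [LinearMap.trace_eq_sum_inner _ (stdOrthonormalBasis ℂ E)]
    refine (norm_sum_le_of_le (n := fun _ => ‖T‖) _ fun i _ => ?_).trans_eq (by simp)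
    refine (norm_inner_le_norm _ _).trans ?_
    rw [OrthonormalBasis.norm_eq_one, one_mul]
    simpa using T.le_opNorm (stdOrthonormalBasis ℂ E i)
  rw [normalizedTrace_apply, norm_mul, norm_inv, Complex.norm_natCast]
  rcases (Nat.cast_nonneg (α := ℝ) (Module.finrank ℂ E)).eq_or_lt with h0 | h0
  · rw [← h0]; simp
  · rwa [inv_mul_le_iff₀ h0]

variable [CompleteSpace E]

theorem trace_star_mul_self (T : E →L[ℂ] E) :
    LinearMap.trace ℂ E ((star T * T : E →L[ℂ] E) : E →ₗ[ℂ] E) =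
      ((∑ i, ‖T (stdOrthonormalBasis ℂ E i)‖ ^ 2 : ℝ) : ℂ) := by
  rw [LinearMap.trace_eq_sum_inner _ (stdOrthonormalBasis ℂ E), Complex.ofReal_sum]
  refine Finset.sum_congr rfl fun i _ => ?_
  change inner ℂ _ ((ContinuousLinearMap.adjoint T) (T _)) = _
  rw [ContinuousLinearMap.adjoint_inner_right, inner_self_eq_norm_sq_to_K]
  simp

theorem normalizedTrace_star_mul_self_nonneg (T : E →L[ℂ] E) :
    0 ≤ normalizedTrace E (star T * T) := by
  rw [normalizedTrace_apply, trace_star_mul_self, ← Complex.ofReal_natCast, ← Complex.ofReal_inv,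
    ← Complex.ofReal_mul, Complex.zero_le_real]
  positivity

theorem eq_zero_of_normalizedTrace_star_mul_self [Nontrivial E] {T : E →L[ℂ] E}
    (h : normalizedTrace E (star T * T) = 0) : T = 0 := by
  rw [normalizedTrace_apply, trace_star_mul_self, mul_eq_zero, Complex.ofReal_eq_zero,
    Finset.sum_eq_zero_iff_of_nonneg fun i _ => by positivity] at h
  have h := h.resolve_left (inv_ne_zero (Nat.cast_ne_zero.2 Module.finrank_pos.ne'))
  refine ContinuousLinearMap.coe_injective ((stdOrthonormalBasis ℂ E).toBasis.ext fun i => ?_)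
  simpa using h i (Finset.mem_univ i)

end Trace

/-! ### Finite-dimensional representations of the soft torus and its faithful trace. -/

namespace SoftTorus

variable {ε : ℝ}

/-- The soft torus has enough finite-dimensional representations. -/
theorem exists_finiteDimensional_rep (hε : 0 ≤ ε) (y : TwoUnitaries) :
    ∃ (E : Type) (_ : NormedAddCommGroup E) (_ : InnerProductSpace ℂ E)
      (_ : FiniteDimensional ℂ E) (_ : CompleteSpace E) (φ : SoftTorus ε →⋆ₐ[ℂ] (E →L[ℂ] E)),
      Nontrivial E ∧ ‖coe ε y‖ ≤ 2 * ‖φ (coe ε y)‖ := by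
  by_cases hy : coe ε y = 0
  -- For `coe ε y = 0` any representation on a nonzero space serves; the trivial one is taken
  -- because the normalized trace needs a nonzero dimension.
  · refine ⟨ℂ, inferInstance, inferInstance, inferInstance, inferInstance,
      lift 1 1 (by simpa using hε), inferInstance, ?_⟩
    rw [hy, norm_zero]
    positivity
  obtain ⟨H, _, _, _, π, ξ, hξ, hπξ⟩ := exists_representation_norm_eq hy
  let a : unitary (H →L[ℂ] H) := ⟨π (u ε), Unitary.map_mem π (u_mem ε)⟩
  let b : unitary (H →L[ℂ] H) := ⟨π (v ε), Unitary.map_mem π (v_mem ε)⟩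
  have hab : ‖(a * b - b * a : H →L[ℂ] H)‖ ≤ ε := by
    change ‖π (u ε) * π (v ε) - π (v ε) * π (u ε)‖ ≤ ε
    rw [← map_mul, ← map_mul, ← map_sub]
    exact (NonUnitalStarAlgHom.norm_apply_le π _).trans (norm_commutator_le hε)
  -- By uniqueness in the universal property, `π` is determined by the pair `a`, `b`, which turns it
  -- into a representation to which the folding applies.
  have hπ : π = lift a b hab := (existsUnique_lift a.2 b.2 hab).unique ⟨rfl, rfl⟩
    ⟨by rw [u, lift_coe, TwoUnitaries.lift_u], by rw [v, lift_coe, TwoUnitaries.lift_v]⟩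
  have hrep : TwoUnitaries.rep (Unitary.linearIsometryEquiv a) (Unitary.linearIsometryEquiv b) y =
      π (coe ε y) := by
    rw [hπ, lift_coe, TwoUnitaries.rep, MulEquiv.symm_apply_apply, MulEquiv.symm_apply_apply]
  obtain ⟨E, _, _, _, _, a', b', hab', hle⟩ := exists_finiteDimensional_approx hε
    (U := Unitary.linearIsometryEquiv a) (V := Unitary.linearIsometryEquiv b)
    (fun x => (a * b - b * a : H →L[ℂ] H).le_of_opNorm_le hab x) y ξ
  rw [hrep, hπξ, hξ, mul_one] at hle
  let φ : SoftTorus ε →⋆ₐ[ℂ] (E →L[ℂ] E) := lift (Unitary.linearIsometryEquiv.symm a')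
    (Unitary.linearIsometryEquiv.symm b') (ContinuousLinearMap.opNorm_le_bound _ hε hab')
  have hφ : φ (coe ε y) = TwoUnitaries.rep a' b' y := lift_coe _ _ _ _
  rw [← hφ] at hle
  refine ⟨E, inferInstance, inferInstance, inferInstance, inferInstance, φ, ?_, hle⟩
  by_contra hE
  rw [not_nontrivial_iff_subsingleton] at hE
  rw [Subsingleton.elim (φ (coe ε y)) 0, norm_zero, mul_zero] at hle
  exact hy (norm_le_zero_iff.1 hle)

/-- The last clause is faithfulness near `y`: a vanishing trace puts `x` in the kernel of the
representation, and `y - x` then has the same image as `y`. -/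
theorem exists_tracial_state (hε : 0 ≤ ε) (y : TwoUnitaries) :
    ∃ τ : SoftTorus ε →ₗ[ℂ] ℂ, (∀ x, 0 ≤ τ (star x * x)) ∧ τ 1 = 1 ∧
      (∀ x z, τ (x * z) = τ (z * x)) ∧ (∀ x, ‖τ x‖ ≤ ‖x‖) ∧
      ∀ x, τ (star x * x) = 0 → ‖coe ε y‖ ≤ 2 * ‖coe ε y - x‖ := by
  obtain ⟨E, _, _, _, _, φ, _, hφ⟩ := exists_finiteDimensional_rep hε y
  have hφle (x : SoftTorus ε) : ‖φ x‖ ≤ ‖x‖ := NonUnitalStarAlgHom.norm_apply_le φ x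
  have hstar (x : SoftTorus ε) : φ (star x * x) = star (φ x) * φ x := by
    rw [map_mul, StarHomClass.map_star]
  refine ⟨normalizedTrace E ∘ₗ (φ : SoftTorus ε →ₗ[ℂ] (E →L[ℂ] E)), fun x => ?_, ?_,
    fun x z => ?_, fun x => ?_, fun x hx => ?_⟩
  · change 0 ≤ normalizedTrace E (φ (star x * x))
    rw [hstar]
    exact normalizedTrace_star_mul_self_nonneg _
  · change normalizedTrace E (φ 1) = 1
    rw [map_one, normalizedTrace_one]
  · change normalizedTrace E (φ (x * z)) = normalizedTrace E (φ (z * x))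
    rw [map_mul φ, map_mul φ, normalizedTrace_mul_comm]
  · exact (norm_normalizedTrace_le _).trans (hφle x)
  · change normalizedTrace E (φ (star x * x)) = 0 at hx
    rw [hstar] at hx
    have h0 := eq_zero_of_normalizedTrace_star_mul_self hx
    calc ‖coe ε y‖ ≤ 2 * ‖φ (coe ε y)‖ := hφ
      _ = 2 * ‖φ (coe ε y - x)‖ := by rw [map_sub, h0, sub_zero]
      _ ≤ 2 * ‖coe ε y - x‖ := by gcongr; exact hφle _

theorem isSeparable_range_coe (ε : ℝ) : TopologicalSpace.IsSeparable (Set.range (coe ε)) := by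
  have h : TopologicalSpace.IsSeparable (Submodule.span ℂ
      (Set.range fun g => coe ε (MonoidAlgebra.single g 1)) : Set (SoftTorus ε)) :=
    (Set.countable_range _).isSeparable.span
  refine h.mono ?_
  rintro _ ⟨x, rfl⟩
  induction x using MonoidAlgebra.induction_linear with
  | zero => rw [map_zero]; exact zero_mem _
  | add x y hx hy => rw [map_add]; exact add_mem hx hy
  | single g c =>
    have h2 : MonoidAlgebra.single g c = c • MonoidAlgebra.single g (1 : ℂ) := by
      simp [MonoidAlgebra.smul_single]
    have h3 : coe ε (c • MonoidAlgebra.single g (1 : ℂ)) =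
      c • coe ε (MonoidAlgebra.single g (1 : ℂ)) := (softSeminorm ε).coe_smul c _
    rw [h2, h3]
    exact Submodule.smul_mem _ c (Submodule.subset_span ⟨g, rfl⟩)

theorem exists_denseRange_seq (ε : ℝ) : ∃ y : ℕ → TwoUnitaries, DenseRange fun n => coe ε (y n) := by
  obtain ⟨t, hts, htc, htd⟩ := (isSeparable_range_coe ε).exists_countable_dense_subset
  have ht : t.Nonempty := by
    rw [Set.nonempty_iff_ne_empty]
    rintro rfl
    simpa using htd ⟨0, rfl⟩
  obtain ⟨z, rfl⟩ := htc.exists_eq_range ht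
  choose y hy using fun n => hts ⟨n, rfl⟩
  refine ⟨y, fun x => ?_⟩
  have hd : DenseRange (coe ε) := (softSeminorm ε).denseRange_coe
  have := closure_minimal htd isClosed_closure (hd x)
  rwa [← funext hy] at this

/-- The trace is `∑ 2⁻⁽ⁿ⁺¹⁾ τ_n` over a dense sequence `y_n`. A sum of nonnegative terms vanishes
only if each term does, so a null `x` is null for every `τ_n`. -/
theorem exists_isFaithfulTracialState (hε : 0 ≤ ε) :
    ∃ τ : SoftTorus ε →ₗ[ℂ] ℂ, IsFaithfulTracialState τ := by
  obtain ⟨y, hy⟩ := exists_denseRange_seq ε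
  choose τ hpos hone hcomm hle hfaith using fun n => exists_tracial_state hε (y n)
  have hw : HasSum (fun n : ℕ => (1 / 2 : ℂ) ^ (n + 1)) 1 := by
    have h := (hasSum_geometric_of_norm_lt_one (ξ := (1 / 2 : ℂ)) (by norm_num)).mul_left (1 / 2)
    norm_num at h
    simpa [pow_succ'] using h
  have hsum (x : SoftTorus ε) : Summable fun n : ℕ => (1 / 2 : ℂ) ^ (n + 1) * τ n x := by
    refine Summable.of_norm_bounded (hw.summable.norm.mul_right ‖x‖) fun n => ?_
    rw [norm_mul]
    gcongr
    exact hle n x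
  have hnonneg (x : SoftTorus ε) (n : ℕ) :
      0 ≤ (1 / 2 : ℂ) ^ (n + 1) * τ n (star x * x) :=
    mul_nonneg (pow_nonneg (by simp) _) (hpos n x)
  refine ⟨{ toFun := fun x => ∑' n : ℕ, (1 / 2 : ℂ) ^ (n + 1) * τ n x
            map_add' := fun x z => ?_
            map_smul' := fun c x => ?_ }, ⟨fun x => ?_, ?_, fun x z => ?_, fun x hx => ?_⟩⟩
  · rw [← (hsum x).tsum_add (hsum z)]
    simp only [map_add, mul_add]
  · rw [RingHom.id_apply, smul_eq_mul, ← tsum_mul_left]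
    simp only [map_smul, smul_eq_mul, mul_left_comm]
  · exact tsum_nonneg (hnonneg x)
  · change ∑' n : ℕ, (1 / 2 : ℂ) ^ (n + 1) * τ n 1 = 1
    simp only [hone, mul_one]
    exact hw.tsum_eq
  · change ∑' n : ℕ, (1 / 2 : ℂ) ^ (n + 1) * τ n (x * z) =
      ∑' n : ℕ, (1 / 2 : ℂ) ^ (n + 1) * τ n (z * x)
    simp only [fun n => hcomm n x z]
  · change ∑' n : ℕ, (1 / 2 : ℂ) ^ (n + 1) * τ n (star x * x) = 0 at hx
    have h1 := (hasSum_zero_iff_of_nonneg (hnonneg x)).1 (hx ▸ (hsum (star x * x)).hasSum)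
    have h2 (n : ℕ) : τ n (star x * x) = 0 :=
      (mul_eq_zero.1 (congrFun h1 n)).resolve_left (pow_ne_zero _ (by norm_num))
    by_contra hx0
    -- If `‖x - y_n‖ < ‖x‖/3`, then `‖y_n‖ > 2‖x‖/3 > 2‖y_n - x‖`, against the bound for `τ_n`.
    have hx3 : 0 < ‖x‖ / 3 := by have := norm_pos_iff.2 hx0; positivity
    obtain ⟨n, hn⟩ := Metric.denseRange_iff.1 hy x _ hx3
    rw [dist_comm, dist_eq_norm] at hn
    have h3 := hfaith n x (h2 n)
    have h4 := norm_sub_norm_le x (coe ε (y n))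
    rw [norm_sub_rev] at h4
    linarith

end SoftTorus

theorem IsHyponormal.isStarNormal {A : Type*} [CStarAlgebra A] [PartialOrder A]
    [StarOrderedRing A] {τ : A →ₗ[ℂ] ℂ} (hτ : IsFaithfulTracialState τ) {x : A}
    (hx : IsHyponormal x) : IsStarNormal x := by
  obtain ⟨y, hy⟩ := CStarAlgebra.nonneg_iff_eq_star_mul_self.1 (sub_nonneg.2 hx)
  have h0 : y = 0 := hτ.faithful y (by rw [← hy, map_sub, hτ.map_mul_comm, sub_self])
  rw [h0, mul_zero, sub_eq_zero] at hy
  exact ⟨hy⟩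

end

theorem mainTheorem3 (ε : ℝ) (hε : 0 ≤ ε) :
    (∃ τ : SoftTorus ε →ₗ[ℂ] ℂ, IsFaithfulTracialState τ) ∧
      ∀ x : SoftTorus ε, IsHyponormal x → IsStarNormal x := by
  obtain ⟨τ, hτ⟩ := SoftTorus.exists_isFaithfulTracialState hε
  exact ⟨⟨τ, hτ⟩, fun x hx => hx.isStarNormal hτ⟩
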